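/- Let $G=(V,E)$ be a finite directed tree with $n=|V|$ vertices: $G$ has no directed cycle, a root vertex $r$ has no parent, every other vertex has exactly one parent, and every vertex is reachable from $r$ by a directed path (for an edge $(v,w)\in E$, $v$ is the parent of $w$). Let $A$ be its incidence matrix: $A_{e,v}=1$ if $e=(v,w)\in E$ for some $w$, $A_{e,v}=-1$ if $e=(w,v)\in E$ for some $w$, and $A_{e,v}=0$ otherwise. Put $\Lambda_G=\{\lambda\in\mathbb R^V:\ \lambda_v>0 \text{ for all } v,\ A\lambda\ge 0\}$ and, for $\beta\in\mathbb R^V$, $$\|\beta\|_{\Lambda_G}=\inf\{\Gamma(\beta,\lambda):\lambda\in\Lambda_G\},\qquad \Gamma(\beta,\lambda)=\frac12\sum_{v\in V}\Big(\frac{\beta_v^2}{\lambda_v}+\lambda_v\Big).$$ For $C\subseteq E$ let $\mathcal V(C)$ be the set of (vertex sets of) connected components of the undirected graph underlying $(V,E\setminus C)$. $C$ is a cut (possibly empty) if, for every edge $(v,w)\in E$, $(v,w)\in C$ if and only if $v$ and $w$ lie in different elements of $\mathcal V(C)$; let $\mathcal C(G)$ be the set of cuts. For nonempty $J\subseteq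 V$ write $\|\beta_{|J}\|_2=\big(\sum_{v\in J}\beta_v^2\big)^{1/2}$. For $V_1,V_2\in\mathcal V(C)$, $V_2$ is below $V_1$ if they are disjoint, at least one edge joins them, and every edge joining them departs from a vertex of $V_1$. For $v\in S\in\mathcal V(C)$ let $D_S(v)$ be the set of $u\in S$ that are reachable from $v$ by a directed path in $G$ (including $u=v$). Let $U_C$ be the set of all $\beta\in(\mathbb R\setminus\{0\})^V$ such that - $\|\beta_{|V_1}\|_2^2/|V_1|>\|\beta_{|V_2}\|_2^2/|V_2|$ whenever $V_1,V_2\in\mathcal V(C)$ and $V_2$ is below $V_1$, and - $\|\beta_{|D_S(v)}\|_2^2/|D_S(v)|\ge\|\beta_{|S}\|_2^2/|S|$ for every $S\in\mathcal V(C)$ and every $v\in S$. Theorem. The sets $U_C$, $C\in\mathcal C(G)$, form a partition of $(\mathbb R\setminus\{0\})^V$: they are nonempty, $U_{C_1}\cap U_{C_2}=\emptyset$ for $C_1\ne C_2$, and their union is $(\mathbb R\setminus\{0\})^V$. In particular, for every $\beta\in(\mathbb R\setminus\{0\})^V$ there is a unique $C\in\mathcal C(G)$ with $\beta\in U_C$,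 and for this $C$ $$\|\beta\|_{\Lambda_G}=\sum_{S\in\mathcal V(C)}\sqrt{|S|}\,\|\beta_{|S}\|_2 .$$ Moreover, $\Gamma(\beta,\cdot)$ has a unique minimizer $\lambda(\beta)$ over $\Lambda_G$, and for every $S\in\mathcal V(C)$ and $v\in S$, $$\lambda_v(\beta)=\sqrt{\frac1{|S|}\sum_{w\in S}\beta_w^2}\,.$$ -/

import Mathlib

namespace GraphPenalty

noncomputable section

variable {V : Type*}

/-! Directed graphs on `V` are given by their edge set `E : Set (V × V)`;
`(v, w) ∈ E` is an edge from `v` (parent) to `w` (child). -/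

/-- The digraph `E` is a directed tree with root `r`: it has no directed cycle, the root has no
parent, every other vertex has exactly one parent, and every vertex can be reached from the root. -/
structure IsDirectedTree (E : Set (V × V)) (r : V) : Prop where
  acyclic : ∀ v, ¬ Relation.TransGen (fun a b => (a, b) ∈ E) v v
  root : ∀ p, (p, r) ∉ E
  parent : ∀ v, v ≠ r → ∃! p, (p, v) ∈ E
  reachable : ∀ v, Relation.ReflTransGen (fun a b => (a, b) ∈ E) r v

open Classical in
/-- The incidence matrix: the row of the edge `(v, w)` has entry `1` at its tail `v`, `-1` at its
head `w`, and `0` elsewhere. -/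
def incidence (E : Set (V × V)) : Matrix E V ℝ :=
  fun e v => if e.1.1 = v then 1 else if e.1.2 = v then -1 else 0

/-- The cone of positive vectors `lam` with `A lam ≥ 0`. -/
def cone [Fintype V] (E : Set (V × V)) : Set (V → ℝ) :=
  {lam | (∀ v, 0 < lam v) ∧ 0 ≤ (incidence E).mulVec lam}

/-- The function `Γ(β, lam) = ½ ∑ (β_v² / lam_v + lam_v)`, used for positive `lam`. -/
def Gam [Fintype V] (β lam : V → ℝ) : ℝ :=
  (1 / 2) * ∑ v, (β v ^ 2 / lam v + lam v)

/-- The penalty `‖β‖_Λ = inf {Γ(β, lam) : lam ∈ Λ}`. -/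
def penalty [Fintype V] (L : Set (V → ℝ)) (β : V → ℝ) : ℝ :=
  sInf (Gam β '' L)

/-- `lam` minimizes `Γ(β, ·)` over `L`. -/
def IsMinimizer [Fintype V] (L : Set (V → ℝ)) (β lam : V → ℝ) : Prop :=
  lam ∈ L ∧ ∀ lam' ∈ L, Gam β lam ≤ Gam β lam'

/-- The Euclidean norm of the restriction of `β` to `S`. -/
def l2 (β : V → ℝ) (S : Finset V) : ℝ :=
  √(∑ v ∈ S, β v ^ 2)

/-- The region where the mean square over `J` exceeds the mean square over `K`. -/
def Q (J K : Finset V) : Set (V → ℝ) :=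
  {β | l2 β K ^ 2 / (K.card : ℝ) < l2 β J ^ 2 / (J.card : ℝ)}

/-- The region where the mean square over `J` is at least the mean square over `K`. For nonempty
`J ≠ K` this is the closure of `Q J K`; for `J = K` it is the whole space. -/
def Qbar (J K : Finset V) : Set (V → ℝ) :=
  {β | l2 β K ^ 2 / (K.card : ℝ) ≤ l2 β J ^ 2 / (J.card : ℝ)}

/-- Two vertices are linked when they are joined by an undirected path of edges in `E \ C`. -/
def Linked (E C : Set (V × V)) : V → V → Prop :=
  Relation.EqvGen (fun v w => (v, w) ∈ E \ C)

open Classical in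
/-- The connected component of `v` once the edges in `C` are removed. -/
def component [Fintype V] (E C : Set (V × V)) (v : V) : Finset V :=
  Finset.univ.filter (fun w => Linked E C v w)

open Classical in
/-- The partition of the vertices induced by `C`: the components left once `C` is removed. -/
def parts [Fintype V] (E C : Set (V × V)) : Finset (Finset V) :=
  Finset.univ.image (component E C)

/-- `C` is a cut (possibly empty): a set of edges which consists exactly of the edges whose ends
lie in different elements of the induced partition. -/
def IsCut [Fintype V] (E C : Set (V × V)) : Prop :=
  C ⊆ E ∧ ∀ v w, (v, w) ∈ E → ((v, w) ∈ C ↔ component E C v ≠ component E C w)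

/-- `V₂` is below `V₁`: the disjoint sets are joined by an edge, and every edge joining them
departs from `V₁`. -/
def Below (E : Set (V × V)) (V₂ V₁ : Finset V) : Prop :=
  Disjoint V₁ V₂ ∧ (∃ v ∈ V₁, ∃ w ∈ V₂, (v, w) ∈ E ∨ (w, v) ∈ E) ∧
    ∀ v ∈ V₁, ∀ w ∈ V₂, (w, v) ∉ E

open Classical in
/-- The descendants of `v` (including `v`) that lie in `S`. -/
def descIn (E : Set (V × V)) (S : Finset V) (v : V) : Finset V :=
  S.filter (fun w => Relation.ReflTransGen (fun a b => (a, b) ∈ E) v w)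

/-- The region `O_C` across the induced partition. -/
def O [Fintype V] (E C : Set (V × V)) : Set (V → ℝ) :=
  {β | ∀ V₁ ∈ parts E C, ∀ V₂ ∈ parts E C, Below E V₂ V₁ → β ∈ Q V₁ V₂}

/-- The region `I_C` within the elements of the induced partition. -/
def I [Fintype V] (E C : Set (V × V)) : Set (V → ℝ) :=
  {β | ∀ S ∈ parts E C, ∀ v ∈ S, β ∈ Qbar (descIn E S v) S}

/-- The vectors all of whose components are nonzero. -/
def nonzeroVecs (V : Type*) : Set (V → ℝ) :=
  {β | ∀ v, β v ≠ 0}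

/-- `U_C = O_C ∩ I_C ∩ (ℝ \ {0})^V`. -/
def U [Fintype V] (E C : Set (V × V)) : Set (V → ℝ) :=
  O E C ∩ I E C ∩ nonzeroVecs V

end

end GraphPenalty

/-! For `β` without zero entries, `Γ(β, ·)` is strictly convex, so its minimizer over the cone is
unique and can be detected by a variational inequality. Up to the factor `½`, the gradient at `λ` is
`1 - β_v² / λ_v²`.

Let `β ∈ U_C` and let `λ` be the root mean square of `β` on each component. The condition `O_C` puts
`λ` in the cone, with a strict drop along every edge between components. On each component, minus
the gradient sums to zero by the choice of the mean, and `I_C` makes its sums over descendants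
nonnegative. Summation by parts along the tree (`IsDirectedTree.sum_mul_nonpos`) then gives the
variational inequality, so `λ` is the minimizer. A cut `C` is the set of edges along which this
minimizer drops, hence is determined by `β`; this is disjointness.

For covering, a minimizer exists by compactness, and `C` is taken to be its set of strict drops.
Shifting the minimizer by plus or minus a component's indicator shows that its value there is the
root mean square; lowering it on descendants within a component gives `I_C`
(`IsMinimizer.mem_U_jumps`). Nonemptiness is by an explicit vector (`U_nonempty`). -/

namespace GraphPenalty

/-! ### Components of a directed tree after edge removal -/

section Components

variable {V : Type*} {E C : Set (V × V)} {r : V}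

lemma Linked.refl (v : V) : Linked E C v v := Relation.EqvGen.refl v

lemma Linked.symm {v w : V} (h : Linked E C v w) : Linked E C w v := Relation.EqvGen.symm _ _ h

lemma Linked.trans {u v w : V} (h : Linked E C u v) (h' : Linked E C v w) : Linked E C u w :=
  Relation.EqvGen.trans _ _ _ h h'

lemma linked_of_edge {v w : V} (h : (v, w) ∈ E) (h' : (v, w) ∉ C) : Linked E C v w :=
  Relation.EqvGen.rel _ _ ⟨h, h'⟩

lemma linked_of_reflTransGen {v w : V}
    (h : Relation.ReflTransGen (fun a b => (a, b) ∈ E \ C) v w) : Linked E C v w := by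
  induction h with
  | refl => exact Linked.refl _
  | tail _ h ih => exact ih.trans (linked_of_edge h.1 h.2)

lemma reach_of_reflTransGen_diff {v w : V}
    (h : Relation.ReflTransGen (fun a b => (a, b) ∈ E \ C) v w) :
    Relation.ReflTransGen (fun a b => (a, b) ∈ E) v w :=
  h.lift id fun _ _ h => h.1

lemma IsDirectedTree.parent_unique (hE : IsDirectedTree E r) {p q v : V}
    (hp : (p, v) ∈ E) (hq : (q, v) ∈ E) : p = q := by
  have hv : v ≠ r := by
    rintro rfl
    exact hE.root _ hp
  exact (hE.parent v hv).unique hp hq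

lemma IsDirectedTree.reach_antisymm (hE : IsDirectedTree E r) {v w : V}
    (h : Relation.ReflTransGen (fun a b => (a, b) ∈ E) v w)
    (h' : Relation.ReflTransGen (fun a b => (a, b) ∈ E) w v) : v = w := by
  rcases Relation.reflTransGen_iff_eq_or_transGen.1 h with h1 | h1
  · exact h1.symm
  · exact (hE.acyclic v (h1.trans_left h')).elim

/-- Two ancestors of the same vertex are comparable. -/
lemma IsDirectedTree.ancestors_comparable (hE : IsDirectedTree E r) {s t v : V}
    (hs : Relation.ReflTransGen (fun a b => (a, b) ∈ E \ C) s v)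
    (ht : Relation.ReflTransGen (fun a b => (a, b) ∈ E \ C) t v) :
    Relation.ReflTransGen (fun a b => (a, b) ∈ E \ C) s t ∨
      Relation.ReflTransGen (fun a b => (a, b) ∈ E \ C) t s := by
  induction hs generalizing t with
  | refl => exact Or.inr ht
  | @tail b c hb hbc ih =>
    rcases Relation.ReflTransGen.cases_tail ht with h | ⟨d, hd, hdc⟩
    · subst h
      exact Or.inl (hb.tail hbc)
    · obtain rfl := hE.parent_unique hbc.1 hdc.1
      exact ih hd

/-- In the transitive case, the two common ancestors both lie above the middle vertex, hence are
comparable, and the higher one serves for the outer pair. -/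
lemma IsDirectedTree.exists_common_ancestor (hE : IsDirectedTree E r) {v w : V}
    (h : Linked E C v w) :
    ∃ t, Relation.ReflTransGen (fun a b => (a, b) ∈ E \ C) t v ∧
      Relation.ReflTransGen (fun a b => (a, b) ∈ E \ C) t w := by
  induction h with
  | rel x y h => exact ⟨x, .refl, .single h⟩
  | refl x => exact ⟨x, .refl, .refl⟩
  | symm x y _ ih =>
    obtain ⟨t, h1, h2⟩ := ih
    exact ⟨t, h2, h1⟩
  | trans x y z _ _ ih1 ih2 =>
    obtain ⟨s, h1, h2⟩ := ih1
    obtain ⟨t, h3, h4⟩ := ih2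
    rcases hE.ancestors_comparable h2 h3 with h | h
    · exact ⟨s, h1, h.trans h4⟩
    · exact ⟨t, h.trans h1, h4⟩

/-- The head of an edge between two components is the top of its component. -/
lemma IsDirectedTree.reach_of_linked (hE : IsDirectedTree E r) {v w x : V} (hvw : (v, w) ∈ E)
    (hne : ¬ Linked E C v w) (hx : Linked E C w x) :
    Relation.ReflTransGen (fun a b => (a, b) ∈ E) w x := by
  obtain ⟨t, h1, h2⟩ := hE.exists_common_ancestor hx
  -- A nontrivial path into `w` inside the component would end with the edge from its only parent
  -- `v`, linking `v` and `w`.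
  rcases Relation.ReflTransGen.cases_tail h1 with h | ⟨d, _, hdw⟩
  · exact h ▸ reach_of_reflTransGen_diff h2
  · obtain rfl := hE.parent_unique hvw hdw.1
    exact (hne (linked_of_edge hdw.1 hdw.2)).elim

lemma Below.exists_edge {V₁ V₂ : Finset V} (h : Below E V₂ V₁) :
    ∃ v ∈ V₁, ∃ w ∈ V₂, (v, w) ∈ E := by
  obtain ⟨_, ⟨v, hv, w, hw, h1 | h1⟩, h2⟩ := h
  · exact ⟨v, hv, w, hw, h1⟩
  · exact (h2 v hv w hw h1).elim

lemma mem_descIn {S : Finset V} {v w : V} :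
    w ∈ descIn E S v ↔ w ∈ S ∧ Relation.ReflTransGen (fun a b => (a, b) ∈ E) v w := by
  simp [descIn]

lemma l2_sq (β : V → ℝ) (S : Finset V) : l2 β S ^ 2 = ∑ v ∈ S, β v ^ 2 :=
  Real.sq_sqrt (Finset.sum_nonneg fun _ _ => sq_nonneg _)

lemma sum_sq_pos {β : V → ℝ} (hβ : β ∈ nonzeroVecs V) {S : Finset V} (hS : S.Nonempty) :
    0 < ∑ w ∈ S, β w ^ 2 :=
  Finset.sum_pos (fun w _ => by have := hβ w; positivity) hS

lemma sum_one_sub_div {β lam : V → ℝ} {D : Finset V} {m : ℝ} (hD : ∀ v ∈ D, lam v = m) :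
    ∑ v ∈ D, (1 - β v ^ 2 / lam v ^ 2) = D.card - (∑ v ∈ D, β v ^ 2) / m ^ 2 := by
  rw [Finset.sum_div]
  have : (D.card : ℝ) = ∑ v ∈ D, (1 : ℝ) := by simp
  rw [this, ← Finset.sum_sub_distrib]
  exact Finset.sum_congr rfl fun v hv => by rw [hD v hv]

lemma l2_sq_div_card_of_const {β : V → ℝ} {S : Finset V} (hS : S.Nonempty) {m : ℝ}
    (h : ∀ v ∈ S, β v = m) : l2 β S ^ 2 / (S.card : ℝ) = m ^ 2 := by
  have hc : (S.card : ℝ) ≠ 0 := by exact_mod_cast (Finset.card_pos.2 hS).ne'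
  rw [l2_sq, Finset.sum_congr rfl fun v hv => by rw [h v hv], Finset.sum_const, nsmul_eq_mul]
  field_simp

/-- The edges along which `lam` is not constant. -/
def jumps (E : Set (V × V)) (lam : V → ℝ) : Set (V × V) :=
  {e | e ∈ E ∧ lam e.1 ≠ lam e.2}

lemma eq_of_linked_jumps {lam : V → ℝ} {v w : V} (h : Linked E (jumps E lam) v w) :
    lam v = lam w := by
  induction h with
  | rel x y h =>
    by_contra hne
    exact h.2 ⟨h.1, hne⟩
  | refl x => rfl
  | symm x y _ ih => exact ih.symm
  | trans x y z _ _ ih1 ih2 => exact ih1.trans ih2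

variable [Fintype V]

lemma mem_component {v w : V} : w ∈ component E C v ↔ Linked E C v w := by
  simp [component]

lemma self_mem_component (v : V) : v ∈ component E C v := mem_component.2 (.refl v)

lemma component_eq_iff {v w : V} : component E C v = component E C w ↔ Linked E C v w := by
  constructor
  · intro h
    exact mem_component.1 (h ▸ self_mem_component w)
  · intro h
    ext u
    rw [mem_component, mem_component]
    exact ⟨fun h' => h.symm.trans h', fun h' => h.trans h'⟩

lemma mem_parts {S : Finset V} : S ∈ parts E C ↔ ∃ v, component E C v = S := by
  simp [parts]

lemma component_mem_parts (v : V) : component E C v ∈ parts E C := mem_parts.2 ⟨v, rfl⟩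

lemma eq_component_of_mem {S : Finset V} (hS : S ∈ parts E C) {v : V} (hv : v ∈ S) :
    component E C v = S := by
  obtain ⟨u, rfl⟩ := mem_parts.1 hS
  exact component_eq_iff.2 (mem_component.1 hv).symm

lemma nonempty_of_mem_parts {S : Finset V} (hS : S ∈ parts E C) : S.Nonempty := by
  obtain ⟨u, rfl⟩ := mem_parts.1 hS
  exact ⟨u, self_mem_component u⟩

lemma sum_parts (f : V → ℝ) : ∑ S ∈ parts E C, ∑ v ∈ S, f v = ∑ v, f v := by
  classical
  rw [← Finset.sum_fiberwise_of_maps_to (s := Finset.univ) (t := parts E C)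
    (g := component E C) (fun v _ => component_mem_parts v)]
  refine Finset.sum_congr rfl fun S hS => Finset.sum_congr ?_ fun _ _ => rfl
  ext v
  simp only [Finset.mem_filter, Finset.mem_univ, true_and]
  exact ⟨fun h => eq_component_of_mem hS h, fun h => h ▸ self_mem_component v⟩

/-- A component of a directed tree has a top vertex from which all its vertices descend. -/
lemma IsDirectedTree.exists_top (hE : IsDirectedTree E r) {S : Finset V} (hS : S ∈ parts E C) :
    ∃ t ∈ S, ∀ v ∈ S, Relation.ReflTransGen (fun a b => (a, b) ∈ E \ C) t v := by
  classical
  obtain ⟨u, rfl⟩ := mem_parts.1 hS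
  have key : ∀ T : Finset V, T ⊆ component E C u →
      ∃ t ∈ component E C u, ∀ v ∈ T, Relation.ReflTransGen (fun a b => (a, b) ∈ E \ C) t v := by
    intro T
    induction T using Finset.induction_on with
    | empty => exact fun _ => ⟨u, self_mem_component u, by simp⟩
    | insert a T _ ih =>
      intro hT
      obtain ⟨t, ht, h⟩ := ih fun x hx => hT (Finset.mem_insert_of_mem hx)
      have ha := mem_component.1 (hT (Finset.mem_insert_self a T))
      rw [mem_component] at ht
      obtain ⟨s, h1, h2⟩ := hE.exists_common_ancestor (ht.symm.trans ha)
      refine ⟨s, mem_component.2 (ht.trans (linked_of_reflTransGen h1).symm), ?_⟩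
      intro v hv
      rcases Finset.mem_insert.1 hv with rfl | hv
      · exact h2
      · exact h1.trans (h v hv)
  exact key _ subset_rfl

/-- The head of an edge between components reaches its whole component, so two such edges in
opposite directions would close a directed cycle. -/
lemma IsDirectedTree.below (hE : IsDirectedTree E r) {v w : V} (hvw : (v, w) ∈ E)
    (hne : ¬ Linked E C v w) : Below E (component E C w) (component E C v) := by
  refine ⟨?_, ⟨v, self_mem_component v, w, self_mem_component w, Or.inl hvw⟩, ?_⟩
  · rw [Finset.disjoint_left]
    intro a ha hb
    exact hne ((mem_component.1 ha).trans (mem_component.1 hb).symm)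
  · intro a ha b hb hba
    rw [mem_component] at ha hb
    have h1 := hE.reach_of_linked hvw hne hb
    have hne' : ¬ Linked E C b a := fun h => hne (ha.trans (h.symm.trans hb.symm))
    have h2 := hE.reach_of_linked hba hne' ha.symm
    exact hE.acyclic b (Relation.TransGen.trans_left (.single hba) (h2.trans
      (Relation.ReflTransGen.trans (.single hvw) h1)))

lemma Below.not_linked {V₁ V₂ : Finset V} (h : Below E V₂ V₁) (h₁ : V₁ ∈ parts E C)
    (h₂ : V₂ ∈ parts E C) {v w : V} (hv : v ∈ V₁) (hw : w ∈ V₂) : ¬ Linked E C v w := by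
  intro hl
  rw [← component_eq_iff, eq_component_of_mem h₁ hv, eq_component_of_mem h₂ hw] at hl
  subst hl
  exact Finset.disjoint_left.1 h.1 hv hv

lemma IsCut.mem_iff (hC : IsCut E C) {v w : V} (h : (v, w) ∈ E) :
    (v, w) ∈ C ↔ ¬ Linked E C v w := by
  rw [hC.2 v w h, ne_eq, component_eq_iff]

end Components

/-! ### The cone, and convexity of `Γ` -/

section Cone

variable {V : Type*} [Fintype V] {E C : Set (V × V)} {r : V}

lemma incidence_mulVec (hE : IsDirectedTree E r) (lam : V → ℝ) (e : E) :
    (incidence E).mulVec lam e = lam e.1.1 - lam e.1.2 := by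
  classical
  obtain ⟨⟨v, w⟩, he⟩ := e
  have hvw : v ≠ w := by
    rintro rfl
    exact hE.acyclic v (.single he)
  have h : ∀ x, incidence E ⟨(v, w), he⟩ x * lam x =
      (if v = x then lam x else 0) - if w = x then lam x else 0 := by
    intro x
    unfold incidence
    dsimp only
    by_cases h1 : v = x
    · subst h1
      simp [hvw.symm]
    · by_cases h2 : w = x <;> simp [h1, h2]
  simp only [Matrix.mulVec, dotProduct, h, Finset.sum_sub_distrib]
  simp

lemma mem_cone (hE : IsDirectedTree E r) {lam : V → ℝ} :
    lam ∈ cone E ↔ (∀ v, 0 < lam v) ∧ ∀ v w, (v, w) ∈ E → lam w ≤ lam v := by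
  refine and_congr Iff.rfl ?_
  simp only [Pi.le_def, incidence_mulVec hE, Pi.zero_apply, sub_nonneg]
  exact ⟨fun h v w hvw => h ⟨(v, w), hvw⟩, fun h e => h _ _ e.2⟩

/-- Exact first-order expansion at `y` of `x ↦ b / x + x`; the remainder is nonnegative for `b ≥ 0`
and `x > 0`, which replaces any appeal to convexity or derivatives. -/
lemma div_add_self_eq {b x y : ℝ} (hx : x ≠ 0) (hy : y ≠ 0) :
    b / x + x = b / y + y + ((1 - b / y ^ 2) * (x - y) + b * (x - y) ^ 2 / (x * y ^ 2)) := by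
  field_simp
  ring

lemma Gam_eq_add (β : V → ℝ) {lam mu : V → ℝ} (hl : ∀ v, 0 < lam v) (hm : ∀ v, 0 < mu v) :
    Gam β lam = Gam β mu + 1 / 2 * (∑ v, (1 - β v ^ 2 / mu v ^ 2) * (lam v - mu v) +
      ∑ v, β v ^ 2 * (lam v - mu v) ^ 2 / (lam v * mu v ^ 2)) := by
  unfold Gam
  rw [← mul_add, ← Finset.sum_add_distrib, ← Finset.sum_add_distrib]
  congr 1
  exact Finset.sum_congr rfl fun v _ => div_add_self_eq (hl v).ne' (hm v).ne'

/-- A point of the cone satisfying the variational inequality is the only minimizer. -/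
lemma isMinimizer_iff_of_variational {L : Set (V → ℝ)} {β mu : V → ℝ} (hβ : β ∈ nonzeroVecs V)
    (hL : ∀ lam ∈ L, ∀ v, 0 < lam v) (hmu : mu ∈ L)
    (hvar : ∀ lam ∈ L, 0 ≤ ∑ v, (1 - β v ^ 2 / mu v ^ 2) * (lam v - mu v)) (lam : V → ℝ) :
    IsMinimizer L β lam ↔ lam = mu := by
  have hterm : ∀ lam ∈ L, ∀ v, 0 ≤ β v ^ 2 * (lam v - mu v) ^ 2 / (lam v * mu v ^ 2) := by
    intro lam hlam v
    have := hL lam hlam v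
    positivity
  constructor
  · rintro ⟨h1, h2⟩
    have h3 := h2 mu hmu
    rw [Gam_eq_add β (hL _ h1) (hL _ hmu)] at h3
    have h4 := hvar lam h1
    have h5 := Finset.sum_nonneg (s := Finset.univ) fun v _ => hterm lam h1 v
    -- The linear part and the remainder are both nonnegative with nonpositive sum. Since `β v ≠ 0`,
    -- a vanishing remainder forces `lam = mu`.
    have h6 : ∑ v, β v ^ 2 * (lam v - mu v) ^ 2 / (lam v * mu v ^ 2) = 0 := by linarith
    rw [Finset.sum_eq_zero_iff_of_nonneg fun v _ => hterm lam h1 v] at h6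
    funext v
    have h7 := h6 v (Finset.mem_univ v)
    have h8 := (hL lam h1 v).ne'
    have h9 := (hL mu hmu v).ne'
    have h10 : β v ≠ 0 := hβ v
    simpa [h8, h9, h10, sub_eq_zero] using h7
  · rintro rfl
    refine ⟨hmu, fun lam' h' => ?_⟩
    rw [Gam_eq_add β (hL _ h') (hL _ hmu)]
    have h4 := hvar lam' h'
    have h5 := Finset.sum_nonneg (s := Finset.univ) fun v _ => hterm lam' h' v
    linarith

end Cone

/-! ### Summation by parts on a component -/

section Abel

variable {V : Type*} [Fintype V] {E C : Set (V × V)} {r : V}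

open Classical in
/-- Summation by parts along a component of the tree: a vector which decreases along the edges
pairs nonpositively with a vector of total sum zero whose sums over descendants are nonnegative. -/
lemma IsDirectedTree.sum_mul_nonpos (hE : IsDirectedTree E r) {S : Finset V}
    (hS : S ∈ parts E C) {c lam : V → ℝ} (hlam : ∀ v w, (v, w) ∈ E → lam w ≤ lam v)
    (hc : ∑ v ∈ S, c v = 0) (hdesc : ∀ v ∈ S, 0 ≤ ∑ u ∈ descIn E S v, c u) :
    ∑ v ∈ S, c v * lam v ≤ 0 := by
  obtain ⟨t, htS, ht⟩ := hE.exists_top hS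
  have hp : ∀ w, ∃ p, w ≠ r → (p, w) ∈ E := by
    intro w
    by_cases h : w = r
    · exact ⟨r, fun h' => (h' h).elim⟩
    · obtain ⟨p, hp, _⟩ := hE.parent w h
      exact ⟨p, fun _ => hp⟩
  choose p hp using hp
  -- The drop of `lam` on the edge entering `w`, set to `0` at the top so that the drops along the
  -- path from `t` to `v` telescope to `lam t - lam v`.
  set δ : V → ℝ := fun w => if w = t then 0 else lam (p w) - lam w with hδ
  have hne : ∀ w ∈ S, w ≠ t → w ≠ r := by
    rintro w hw hwt rfl
    rcases Relation.ReflTransGen.cases_tail (ht w hw) with h | ⟨d, _, hd⟩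
    · exact hwt h
    · exact hE.root _ hd.1
  have hδ0 : ∀ w ∈ S, 0 ≤ δ w := by
    intro w hw
    by_cases h : w = t
    · simp [hδ, h]
    · simp only [hδ, h, if_false, sub_nonneg]
      exact hlam _ _ (hp w (hne w hw h))
  have hpath : ∀ v, Relation.ReflTransGen (fun a b => (a, b) ∈ E \ C) t v →
      v ∈ S ∧ ∑ w ∈ S with Relation.ReflTransGen (fun a b => (a, b) ∈ E) w v, δ w
        = lam t - lam v := by
    intro v hv
    induction hv with
    | refl =>
      refine ⟨htS, ?_⟩
      rw [sub_self]
      refine Finset.sum_eq_zero fun w hw => ?_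
      rw [Finset.mem_filter] at hw
      have := hE.reach_antisymm hw.2 (reach_of_reflTransGen_diff (ht w hw.1))
      simp [hδ, this]
    | @tail a b hta hab ih =>
      obtain ⟨haS, ih⟩ := ih
      have hbS : b ∈ S := by
        rw [← eq_component_of_mem hS haS, mem_component]
        exact linked_of_edge hab.1 hab.2
      refine ⟨hbS, ?_⟩
      have hbt : b ≠ t := by
        rintro rfl
        exact hE.acyclic b (Relation.TransGen.tail' (reach_of_reflTransGen_diff hta) hab.1)
      have hset : S.filter (fun w => Relation.ReflTransGen (fun a b => (a, b) ∈ E) w b) =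
          insert b (S.filter fun w => Relation.ReflTransGen (fun a b => (a, b) ∈ E) w a) := by
        ext w
        simp only [Finset.mem_filter, Finset.mem_insert]
        constructor
        · rintro ⟨hw, hwb⟩
          rcases Relation.ReflTransGen.cases_tail hwb with h | ⟨d, hd, hdb⟩
          · exact Or.inl h.symm
          · obtain rfl := hE.parent_unique hab.1 hdb
            exact Or.inr ⟨hw, hd⟩
        · rintro (rfl | ⟨hw, hwa⟩)
          · exact ⟨hbS, .refl⟩
          · exact ⟨hw, hwa.tail hab.1⟩
      have hnot : b ∉ S.filter fun w => Relation.ReflTransGen (fun a b => (a, b) ∈ E) w a := by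
        intro h
        exact hE.acyclic b (Relation.TransGen.tail' (Finset.mem_filter.1 h).2 hab.1)
      rw [hset, Finset.sum_insert hnot, ih]
      have : p b = a := hE.parent_unique (hp b (hne b hbS hbt)) hab.1
      simp only [hδ, hbt, if_false, this]
      ring
  have hlam' : ∀ v ∈ S, c v * lam v = c v * lam t -
      ∑ w ∈ S, if Relation.ReflTransGen (fun a b => (a, b) ∈ E) w v then δ w * c v else 0 := by
    intro v hv
    have h := (hpath v (ht v hv)).2
    rw [Finset.sum_filter] at h
    have h2 : (∑ w ∈ S, if Relation.ReflTransGen (fun a b => (a, b) ∈ E) w v then δ w * c v else 0)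
        = (lam t - lam v) * c v := by
      rw [← h, Finset.sum_mul]
      refine Finset.sum_congr rfl fun w _ => ?_
      split_ifs <;> simp
    rw [h2]
    ring
  -- The `lam t` part vanishes with the total of `c`; exchanging the sums collects, for each drop `δ
  -- w`, the sum of `c` over the descendants of `w`.
  rw [Finset.sum_congr rfl hlam', Finset.sum_sub_distrib, ← Finset.sum_mul, hc, zero_mul,
    zero_sub, neg_nonpos, Finset.sum_comm]
  refine Finset.sum_nonneg fun w hw => ?_
  rw [← Finset.sum_filter, ← Finset.mul_sum]
  have hset : S.filter (fun v => Relation.ReflTransGen (fun a b => (a, b) ∈ E) w v) =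
      descIn E S w := by
    ext v
    rw [mem_descIn, Finset.mem_filter]
  rw [hset]
  exact mul_nonneg (hδ0 w hw) (hdesc w hw)

end Abel

/-! ### The blockwise root mean square as the minimizer -/

section Pooled

variable {V : Type*} [Fintype V] {E C : Set (V × V)} {r : V}

/-- The vector which is constant on each component, equal to the root mean square of `β`. -/
noncomputable def pooled (E C : Set (V × V)) (β : V → ℝ) (v : V) : ℝ :=
  √((1 / ((component E C v).card : ℝ)) * ∑ w ∈ component E C v, β w ^ 2)

lemma pooled_of_mem (β : V → ℝ) {S : Finset V} (hS : S ∈ parts E C) {v : V} (hv : v ∈ S) :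
    pooled E C β v = √((1 / (S.card : ℝ)) * ∑ w ∈ S, β w ^ 2) := by
  rw [pooled, eq_component_of_mem hS hv]

lemma card_component_pos (v : V) : 0 < ((component E C v).card : ℝ) := by
  exact_mod_cast Finset.card_pos.2 ⟨v, self_mem_component v⟩

lemma pooled_pos {β : V → ℝ} (hβ : β ∈ nonzeroVecs V) (v : V) : 0 < pooled E C β v := by
  have h1 := card_component_pos (E := E) (C := C) v
  have h2 := sum_sq_pos hβ ⟨v, self_mem_component (E := E) (C := C) v⟩
  exact Real.sqrt_pos.2 (by positivity)

lemma pooled_sq (β : V → ℝ) (v : V) :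
    pooled E C β v ^ 2 = l2 β (component E C v) ^ 2 / ((component E C v).card : ℝ) := by
  have h2 : 0 ≤ ∑ w ∈ component E C v, β w ^ 2 := Finset.sum_nonneg fun _ _ => sq_nonneg _
  rw [pooled, Real.sq_sqrt (by positivity), l2_sq]
  ring

lemma pooled_congr (β : V → ℝ) {v w : V} (h : Linked E C v w) :
    pooled E C β v = pooled E C β w := by
  rw [pooled, pooled, component_eq_iff.2 h]

lemma pooled_lt (hE : IsDirectedTree E r) {β : V → ℝ} (hβ : β ∈ U E C) {v w : V}
    (hvw : (v, w) ∈ E) (hne : ¬ Linked E C v w) : pooled E C β w < pooled E C β v := by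
  have h := hβ.1.1 _ (component_mem_parts v) _ (component_mem_parts w) (hE.below hvw hne)
  rw [Q, Set.mem_ofPred_eq, ← pooled_sq, ← pooled_sq] at h
  exact lt_of_pow_lt_pow_left₀ 2 (Real.sqrt_nonneg _) h

lemma pooled_mem_cone (hE : IsDirectedTree E r) {β : V → ℝ} (hβ : β ∈ U E C) :
    pooled E C β ∈ cone E := by
  refine (mem_cone hE).2 ⟨pooled_pos hβ.2, fun v w hvw => ?_⟩
  by_cases h : Linked E C v w
  · exact (pooled_congr β h).ge
  · exact (pooled_lt hE hβ hvw h).le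

lemma pooled_variational (hE : IsDirectedTree E r) {β : V → ℝ} (hβ : β ∈ U E C) {lam : V → ℝ}
    (hlam : lam ∈ cone E) :
    0 ≤ ∑ v, (1 - β v ^ 2 / pooled E C β v ^ 2) * (lam v - pooled E C β v) := by
  rw [← sum_parts (E := E) (C := C)]
  refine Finset.sum_nonneg fun S hS => ?_
  obtain ⟨u, rfl⟩ := mem_parts.1 hS
  set m := pooled E C β u with hm
  have hmpos : 0 < m := pooled_pos hβ.2 u
  have hcard := card_component_pos (E := E) (C := C) u
  have hmS : ∀ v ∈ component E C u, pooled E C β v = m := fun v hv =>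
    (pooled_congr β (mem_component.1 hv)).symm
  have hsum : ∑ v ∈ component E C u, β v ^ 2 = (component E C u).card * m ^ 2 := by
    rw [hm, pooled_sq, l2_sq]
    field_simp
  have h0 : ∑ v ∈ component E C u, (β v ^ 2 / m ^ 2 - 1) = 0 := by
    rw [Finset.sum_sub_distrib, ← Finset.sum_div, hsum, Finset.sum_const, nsmul_eq_mul]
    field_simp
    ring
  have hd : ∀ v ∈ component E C u,
      0 ≤ ∑ w ∈ descIn E (component E C u) v, (β w ^ 2 / m ^ 2 - 1) := by
    intro v hv
    have h := hβ.1.2 _ hS v hv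
    rw [Qbar, Set.mem_ofPred_eq, ← pooled_sq, ← hm, l2_sq] at h
    have hpos : 0 < ((descIn E (component E C u) v).card : ℝ) := by
      exact_mod_cast Finset.card_pos.2 ⟨v, mem_descIn.2 ⟨hv, .refl⟩⟩
    rw [le_div_iff₀ hpos] at h
    rw [Finset.sum_sub_distrib, ← Finset.sum_div, Finset.sum_const, nsmul_eq_mul, mul_one,
      sub_nonneg, le_div_iff₀ (by positivity)]
    linarith
  -- Here `c` is minus the gradient factor: `h0` says that `m ^ 2` is the mean square, and `hd` is
  -- the condition `I_C`.
  have key := hE.sum_mul_nonpos hS ((mem_cone hE).1 hlam).2 h0 hd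
  have heq : ∑ v ∈ component E C u, (1 - β v ^ 2 / pooled E C β v ^ 2) * (lam v - pooled E C β v)
      = (∑ v ∈ component E C u, (β v ^ 2 / m ^ 2 - 1)) * m -
        ∑ v ∈ component E C u, (β v ^ 2 / m ^ 2 - 1) * lam v := by
    rw [Finset.sum_mul, ← Finset.sum_sub_distrib]
    refine Finset.sum_congr rfl fun v hv => ?_
    rw [hmS v hv]
    ring
  rw [heq, h0]
  linarith

lemma isMinimizer_iff_eq_pooled (hE : IsDirectedTree E r) {β : V → ℝ} (hβ : β ∈ U E C)
    (lam : V → ℝ) : IsMinimizer (cone E) β lam ↔ lam = pooled E C β :=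
  isMinimizer_iff_of_variational hβ.2 (fun _ h => h.1) (pooled_mem_cone hE hβ)
    (fun _ h => pooled_variational hE hβ h) lam

lemma Gam_pooled {β : V → ℝ} (hβ : β ∈ nonzeroVecs V) :
    Gam β (pooled E C β) = ∑ S ∈ parts E C, √(S.card : ℝ) * l2 β S := by
  rw [Gam, ← sum_parts (E := E) (C := C), Finset.mul_sum]
  refine Finset.sum_congr rfl fun S hS => ?_
  have hcard : 0 < (S.card : ℝ) := by exact_mod_cast Finset.card_pos.2 (nonempty_of_mem_parts hS)
  have hpos := sum_sq_pos hβ (nonempty_of_mem_parts hS)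
  have hl : 0 < l2 β S := Real.sqrt_pos.2 hpos
  have hs : 0 < √(S.card : ℝ) := Real.sqrt_pos.2 hcard
  have hm : ∀ v ∈ S, pooled E C β v = l2 β S / √(S.card : ℝ) := by
    intro v hv
    rw [pooled_of_mem β hS hv, l2, ← Real.sqrt_div' _ hcard.le]
    congr 1
    ring
  have : ∑ v ∈ S, (β v ^ 2 / pooled E C β v + pooled E C β v) =
      ∑ v ∈ S, (β v ^ 2 / (l2 β S / √(S.card : ℝ)) + l2 β S / √(S.card : ℝ)) :=
    Finset.sum_congr rfl fun v hv => by rw [hm v hv]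
  rw [this, Finset.sum_add_distrib, ← Finset.sum_div, ← l2_sq, Finset.sum_const, nsmul_eq_mul]
  have hc : (S.card : ℝ) = √(S.card : ℝ) ^ 2 := (Real.sq_sqrt hcard.le).symm
  generalize √(S.card : ℝ) = q at *
  rw [hc]
  field_simp
  ring

/-- The cut is recovered from the minimizer as the set of edges along which it decreases. -/
lemma mem_cut_iff_pooled_lt (hE : IsDirectedTree E r) (hC : IsCut E C) {β : V → ℝ}
    (hβ : β ∈ U E C) (v w : V) :
    (v, w) ∈ C ↔ (v, w) ∈ E ∧ pooled E C β w < pooled E C β v := by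
  constructor
  · intro h
    have hvw := hC.1 h
    exact ⟨hvw, pooled_lt hE hβ hvw ((hC.mem_iff hvw).1 h)⟩
  · rintro ⟨hvw, h⟩
    exact (hC.mem_iff hvw).2 fun hl => h.ne' (pooled_congr β hl)

lemma cut_unique (hE : IsDirectedTree E r) {C₁ C₂ : Set (V × V)} (h₁ : IsCut E C₁)
    (h₂ : IsCut E C₂) {β : V → ℝ} (hβ₁ : β ∈ U E C₁) (hβ₂ : β ∈ U E C₂) : C₁ = C₂ := by
  have h : pooled E C₁ β = pooled E C₂ β :=
    (isMinimizer_iff_eq_pooled hE hβ₂ _).1 ((isMinimizer_iff_eq_pooled hE hβ₁ _).2 rfl)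
  ext ⟨v, w⟩
  rw [mem_cut_iff_pooled_lt hE h₁ hβ₁, mem_cut_iff_pooled_lt hE h₂ hβ₂, h]

end Pooled

/-! ### Existence of a minimizer, and the cut it defines -/

section Existence

variable {V : Type*} [Fintype V] {E C : Set (V × V)} {r : V}

/-- The cone is neither closed nor bounded, but where `Γ` is at most its value at the constant
vector `1`, each summand is at most `M`. This confines `lam v` to `[β v ^ 2 / M, M]`, away from `0`
because `β v ≠ 0`. -/
lemma exists_isMinimizer (hE : IsDirectedTree E r) {β : V → ℝ} (hβ : β ∈ nonzeroVecs V) :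
    ∃ lam, IsMinimizer (cone E) β lam := by
  have h1 : (fun _ => 1 : V → ℝ) ∈ cone E := (mem_cone hE).2 ⟨fun _ => one_pos, fun _ _ _ => le_rfl⟩
  have hterm : ∀ lam ∈ cone E, ∀ v, 0 ≤ β v ^ 2 / lam v + lam v := by
    intro lam hlam v
    have := hlam.1 v
    positivity
  set M : ℝ := 2 * Gam β fun _ => 1 with hM
  have hMle : ∀ lam ∈ cone E, Gam β lam ≤ Gam β (fun _ => 1) →
      ∀ v, β v ^ 2 / lam v + lam v ≤ M := by
    intro lam hlam h v
    have h3 := Finset.single_le_sum (fun v _ => hterm lam hlam v) (Finset.mem_univ v)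
    rw [Gam] at h
    linarith
  have hMpos : 0 < M := by
    have := hMle _ h1 le_rfl r
    have h2 := sq_nonneg (β r)
    rw [div_one] at this
    linarith
  have hb : ∀ v, 0 < β v ^ 2 / M := fun v => by
    have := hβ v
    positivity
  set K : Set (V → ℝ) := Set.Icc (fun v => β v ^ 2 / M) (fun _ => M) ∩
    {lam | ∀ v w, (v, w) ∈ E → lam w ≤ lam v} with hK
  have hKcone : K ⊆ cone E := fun lam h =>
    (mem_cone hE).2 ⟨fun v => (hb v).trans_le (h.1.1 v), h.2⟩
  have hKmem : ∀ lam ∈ cone E, Gam β lam ≤ Gam β (fun _ => 1) → lam ∈ K := by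
    intro lam hlam h
    have h2 := hMle lam hlam h
    refine ⟨⟨fun v => ?_, fun v => ?_⟩, ((mem_cone hE).1 hlam).2⟩
    · have h3 := hlam.1 v
      have h4 : β v ^ 2 / lam v ≤ M := by linarith [h2 v]
      rw [div_le_iff₀ h3] at h4
      change β v ^ 2 / M ≤ lam v
      rw [div_le_iff₀ hMpos]
      linarith
    · have h3 := hlam.1 v
      have h4 : 0 ≤ β v ^ 2 / lam v := by positivity
      change lam v ≤ M
      linarith [h2 v]
  have hclosed : IsClosed {lam : V → ℝ | ∀ v w, (v, w) ∈ E → lam w ≤ lam v} := by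
    simp only [Set.ofPred_forall]
    exact isClosed_iInter fun v => isClosed_iInter fun w => isClosed_iInter fun _ =>
      isClosed_le (continuous_apply w) (continuous_apply v)
  have hcompact : IsCompact K := isCompact_Icc.inter_right hclosed
  have hcont : ContinuousOn (Gam β) K := by
    unfold Gam
    refine continuousOn_const.mul (continuousOn_finsetSum _ fun v _ => ?_)
    exact (continuousOn_const.div (continuous_apply v).continuousOn
      fun lam h => ((hKcone h).1 v).ne').add (continuous_apply v).continuousOn
  obtain ⟨lam, hlam, hmin⟩ := hcompact.exists_isMinOn ⟨_, hKmem _ h1 le_rfl⟩ hcont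
  refine ⟨lam, hKcone hlam, fun lam' h' => ?_⟩
  by_cases h : Gam β lam' ≤ Gam β fun _ => 1
  · exact hmin (hKmem lam' h' h)
  · exact (hmin (hKmem _ h1 le_rfl)).trans (not_le.1 h).le

/-- First-order condition along a direction which is feasible at the minimizer. -/
lemma IsMinimizer.sum_nonneg (hE : IsDirectedTree E r) {β lam : V → ℝ}
    (h : IsMinimizer (cone E) β lam) {d : V → ℝ}
    (hd : ∀ v w, (v, w) ∈ E → lam v = lam w → d w ≤ d v) :
    0 ≤ ∑ v, (1 - β v ^ 2 / lam v ^ 2) * d v := by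
  have hpos := h.1.1
  have hmono := ((mem_cone hE).1 h.1).2
  have hcont : ∀ v, Filter.Tendsto (fun t : ℝ => lam v + t * d v) (nhdsWithin 0 (Set.Ioi 0))
      (nhds (lam v)) := by
    intro v
    have : Continuous fun t : ℝ => lam v + t * d v := by fun_prop
    simpa using (this.tendsto 0).mono_left nhdsWithin_le_nhds
  -- Strict constraints survive a small step by continuity; tight ones are preserved by `hd`.
  have hfeas : ∀ᶠ t in nhdsWithin (0 : ℝ) (Set.Ioi 0), (fun v => lam v + t * d v) ∈ cone E := by
    have e1 : ∀ᶠ t in nhdsWithin (0 : ℝ) (Set.Ioi 0), ∀ v, 0 < lam v + t * d v :=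
      Filter.eventually_all.2 fun v => (hcont v).eventually_const_lt (hpos v)
    have e2 : ∀ᶠ t in nhdsWithin (0 : ℝ) (Set.Ioi 0), ∀ v w, (v, w) ∈ E →
        lam w + t * d w ≤ lam v + t * d v := by
      refine Filter.eventually_all.2 fun v => Filter.eventually_all.2 fun w => ?_
      by_cases hvw : (v, w) ∈ E
      · rcases (hmono v w hvw).eq_or_lt with heq | hlt
        · filter_upwards [self_mem_nhdsWithin] with t ht _
          rw [heq]
          have := mul_le_mul_of_nonneg_left (hd v w hvw heq.symm) (le_of_lt (Set.mem_Ioi.1 ht))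
          linarith
        · filter_upwards [(hcont w).eventually_lt (hcont v) hlt] with t ht _ using ht.le
      · exact Filter.Eventually.of_forall fun _ h => (hvw h).elim
    filter_upwards [e1, e2] with t h1 h2 using (mem_cone hE).2 ⟨h1, h2⟩
  -- Twice the difference quotient of `Γ` in direction `d`, read off from the exact expansion;
  -- minimality makes it nonnegative for small `t > 0`.
  have hlim : Filter.Tendsto (fun t : ℝ => ∑ v, (1 - β v ^ 2 / lam v ^ 2) * d v +
      ∑ v, β v ^ 2 * d v ^ 2 * t / ((lam v + t * d v) * lam v ^ 2))
      (nhdsWithin 0 (Set.Ioi 0)) (nhds (∑ v, (1 - β v ^ 2 / lam v ^ 2) * d v)) := by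
    have : Filter.Tendsto (fun t : ℝ =>
        ∑ v, β v ^ 2 * d v ^ 2 * t / ((lam v + t * d v) * lam v ^ 2))
        (nhdsWithin 0 (Set.Ioi 0)) (nhds (∑ v : V, (0 : ℝ))) := by
      refine tendsto_finsetSum _ fun v _ => ?_
      have hn : Filter.Tendsto (fun t : ℝ => β v ^ 2 * d v ^ 2 * t)
          (nhdsWithin 0 (Set.Ioi 0)) (nhds 0) := by
        have : Continuous fun t : ℝ => β v ^ 2 * d v ^ 2 * t := by fun_prop
        simpa using (this.tendsto 0).mono_left nhdsWithin_le_nhds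
      have hv := (hpos v).ne'
      have hquot := hn.div ((hcont v).mul_const (lam v ^ 2)) (by positivity)
      rw [zero_div] at hquot
      exact hquot
    simpa using this.const_add (∑ v, (1 - β v ^ 2 / lam v ^ 2) * d v)
  refine ge_of_tendsto hlim ?_
  filter_upwards [hfeas, self_mem_nhdsWithin] with t hmem ht
  have ht : 0 < t := ht
  have h1 := h.2 _ hmem
  rw [Gam_eq_add β hmem.1 hpos] at h1
  have h2 : ∑ v, (1 - β v ^ 2 / lam v ^ 2) * (lam v + t * d v - lam v) +
      ∑ v, β v ^ 2 * (lam v + t * d v - lam v) ^ 2 / ((lam v + t * d v) * lam v ^ 2) =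
      t * (∑ v, (1 - β v ^ 2 / lam v ^ 2) * d v +
      ∑ v, β v ^ 2 * d v ^ 2 * t / ((lam v + t * d v) * lam v ^ 2)) := by
    rw [mul_add, Finset.mul_sum, Finset.mul_sum]
    congr 1 <;> refine Finset.sum_congr rfl fun v _ => ?_ <;> ring
  rw [h2] at h1
  exact nonneg_of_mul_nonneg_right (by linarith) ht

lemma isCut_jumps (lam : V → ℝ) : IsCut E (jumps E lam) := by
  refine ⟨fun e h => h.1, fun v w hvw => ?_⟩
  rw [ne_eq, component_eq_iff]
  exact ⟨fun h hl => h.2 (eq_of_linked_jumps hl), fun h => by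
    by_contra hn
    exact h (linked_of_edge hvw hn)⟩

lemma mem_component_iff_of_edge {lam : V → ℝ} {u v w : V} (hvw : (v, w) ∈ E)
    (h : lam v = lam w) :
    v ∈ component E (jumps E lam) u ↔ w ∈ component E (jumps E lam) u := by
  have hl : Linked E (jumps E lam) v w := linked_of_edge hvw fun hj => hj.2 h
  rw [mem_component, mem_component]
  exact ⟨fun h' => h'.trans hl, fun h' => h'.trans hl.symm⟩

open Classical in
lemma IsMinimizer.mem_U_jumps (hE : IsDirectedTree E r) {β lam : V → ℝ}
    (hβ : β ∈ nonzeroVecs V) (h : IsMinimizer (cone E) β lam) : β ∈ U E (jumps E lam) := by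
  have hpos := h.1.1
  have hmean : ∀ u, l2 β (component E (jumps E lam) u) ^ 2 /
      ((component E (jumps E lam) u).card : ℝ) = lam u ^ 2 := by
    intro u
    have hconst : ∀ v ∈ component E (jumps E lam) u, lam v = lam u := fun v hv =>
      (eq_of_linked_jumps (mem_component.1 hv)).symm
    -- The indicator of a component is constant along tight edges, so both signs are feasible and
    -- the two inequalities give equality.
    have h1 := h.sum_nonneg hE (d := fun v => if v ∈ component E (jumps E lam) u then 1 else 0)
      fun v w hvw heq => by simp [mem_component_iff_of_edge hvw heq]
    have h2 := h.sum_nonneg hE (d := fun v => if v ∈ component E (jumps E lam) u then -1 else 0)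
      fun v w hvw heq => by simp [mem_component_iff_of_edge hvw heq]
    simp only [mul_ite, mul_one, mul_neg, mul_zero, Finset.sum_ite_mem, Finset.univ_inter,
      Finset.sum_neg_distrib] at h1 h2
    rw [sum_one_sub_div hconst] at h1 h2
    have h3 := hpos u
    have h4 := card_component_pos (E := E) (C := jumps E lam) u
    have h5 : (∑ v ∈ component E (jumps E lam) u, β v ^ 2) / lam u ^ 2 =
      (component E (jumps E lam) u).card := by linarith
    rw [div_eq_iff (by positivity)] at h5
    rw [l2_sq, h5]
    field_simp
  refine ⟨⟨?_, ?_⟩, hβ⟩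
  · intro V₁ h₁ V₂ h₂ hb
    obtain ⟨v, hv, w, hw, hvw⟩ := hb.exists_edge
    have hC := ((isCut_jumps lam).mem_iff hvw).2 (hb.not_linked h₁ h₂ hv hw)
    rw [Q, Set.mem_ofPred_eq, ← eq_component_of_mem h₁ hv, ← eq_component_of_mem h₂ hw, hmean,
      hmean]
    have hlt := lt_of_le_of_ne (((mem_cone hE).1 h.1).2 v w hvw) (Ne.symm hC.2)
    exact pow_lt_pow_left₀ hlt (hpos w).le two_ne_zero
  · intro S hS v hv
    rw [Qbar, Set.mem_ofPred_eq, ← eq_component_of_mem hS hv, hmean, l2_sq]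
    have hconst : ∀ w ∈ descIn E (component E (jumps E lam) v) v, lam w = lam v := fun w hw =>
      (eq_of_linked_jumps (mem_component.1 (mem_descIn.1 hw).1)).symm
    -- Descendants within the component are closed downward along tight edges, so lowering `lam` on
    -- them is feasible; raising it need not be, hence only an inequality.
    have h2 := h.sum_nonneg hE
      (d := fun w => if w ∈ descIn E (component E (jumps E lam) v) v then -1 else 0) (by
        intro a b hab heq
        have himp : a ∈ descIn E (component E (jumps E lam) v) v →
            b ∈ descIn E (component E (jumps E lam) v) v := by
          intro ha
          rw [mem_descIn] at ha ⊢
          exact ⟨(mem_component_iff_of_edge hab heq).1 ha.1, ha.2.tail hab⟩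
        by_cases ha : a ∈ descIn E (component E (jumps E lam) v) v
        · simp [ha, himp ha]
        · simp only [ha, if_false]
          split_ifs <;> norm_num)
    simp only [mul_ite, mul_one, mul_neg, mul_zero, Finset.sum_ite_mem, Finset.univ_inter,
      Finset.sum_neg_distrib] at h2
    rw [sum_one_sub_div hconst] at h2
    have hc : 0 < ((descIn E (component E (jumps E lam) v) v).card : ℝ) := by
      exact_mod_cast Finset.card_pos.2 ⟨v, mem_descIn.2 ⟨self_mem_component v, .refl⟩⟩
    have h3 := hpos v
    have h4 : ((descIn E (component E (jumps E lam) v) v).card : ℝ) ≤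
      (∑ w ∈ descIn E (component E (jumps E lam) v) v, β w ^ 2) / lam v ^ 2 := by linarith
    rw [le_div_iff₀ (by positivity)] at h4
    rw [le_div_iff₀ hc]
    linarith

lemma exists_cut (hE : IsDirectedTree E r) {β : V → ℝ} (hβ : β ∈ nonzeroVecs V) :
    ∃ C, IsCut E C ∧ β ∈ U E C := by
  obtain ⟨lam, h⟩ := exists_isMinimizer hE hβ
  exact ⟨_, isCut_jumps lam, h.mem_U_jumps hE hβ⟩

end Existence

/-! ### An explicit element of each region -/

section Nonempty

variable {V : Type*} [Fintype V] {E C : Set (V × V)} {r : V}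

open Classical in
/-- The vertices which descend from some vertex of the component of `v`. -/
noncomputable def descComponent (E C : Set (V × V)) (v : V) : Finset V :=
  Finset.univ.filter fun u =>
    ∃ x ∈ component E C v, Relation.ReflTransGen (fun a b => (a, b) ∈ E) x u

lemma mem_descComponent {u v : V} : u ∈ descComponent E C v ↔
    ∃ x ∈ component E C v, Relation.ReflTransGen (fun a b => (a, b) ∈ E) x u := by
  simp [descComponent]

lemma self_mem_descComponent (v : V) : v ∈ descComponent E C v :=
  mem_descComponent.2 ⟨v, self_mem_component v, .refl⟩

lemma IsDirectedTree.card_descComponent_lt (hE : IsDirectedTree E r) {v w : V}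
    (hvw : (v, w) ∈ E) (hne : ¬ Linked E C v w) :
    (descComponent E C w).card < (descComponent E C v).card := by
  have hreach : ∀ u ∈ descComponent E C w,
      Relation.ReflTransGen (fun a b => (a, b) ∈ E) w u := by
    intro u hu
    obtain ⟨x, hx, hxu⟩ := mem_descComponent.1 hu
    exact (hE.reach_of_linked hvw hne (mem_component.1 hx)).trans hxu
  refine Finset.card_lt_card (Finset.ssubset_iff_subset_ne.2 ⟨fun u hu => ?_, fun heq => ?_⟩)
  · exact mem_descComponent.2 ⟨v, self_mem_component v, .head hvw (hreach u hu)⟩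
  · exact hE.acyclic v (.head' hvw (hreach v (heq ▸ self_mem_descComponent v)))

/-- Counting the descendants of a vertex's component gives a vector constant on components and
strictly decreasing across edges between them, so `I_C` holds with equality. -/
lemma U_nonempty (hE : IsDirectedTree E r) : (U E C).Nonempty := by
  set β : V → ℝ := fun v => ((descComponent E C v).card : ℝ) with hβ
  have hpos : ∀ v, 0 < β v := fun v => by
    simp only [hβ]
    exact_mod_cast Finset.card_pos.2 ⟨v, self_mem_descComponent v⟩
  have hconst : ∀ S ∈ parts E C, ∀ v ∈ S, ∀ w ∈ S, β w = β v := by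
    intro S hS v hv w hw
    have heq : descComponent E C w = descComponent E C v := by
      ext u
      rw [mem_descComponent, mem_descComponent, eq_component_of_mem hS hv,
        eq_component_of_mem hS hw]
    simp only [hβ, heq]
  refine ⟨β, ⟨?_, ?_⟩, fun v => (hpos v).ne'⟩
  · intro V₁ h₁ V₂ h₂ hb
    obtain ⟨v, hv, w, hw, hvw⟩ := hb.exists_edge
    rw [Q, Set.mem_ofPred_eq, l2_sq_div_card_of_const ⟨v, hv⟩ (hconst V₁ h₁ v hv),
      l2_sq_div_card_of_const ⟨w, hw⟩ (hconst V₂ h₂ w hw)]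
    refine pow_lt_pow_left₀ ?_ (hpos w).le two_ne_zero
    simp only [hβ]
    exact_mod_cast hE.card_descComponent_lt hvw (hb.not_linked h₁ h₂ hv hw)
  · intro S hS v hv
    rw [Qbar, Set.mem_ofPred_eq, l2_sq_div_card_of_const ⟨v, hv⟩ (hconst S hS v hv),
      l2_sq_div_card_of_const ⟨v, mem_descIn.2 ⟨hv, .refl⟩⟩
        fun w hw => hconst S hS v hv w (mem_descIn.1 hw).1]

end Nonempty

lemma penalty_eq_of_isMinimizer {V : Type*} [Fintype V] {L : Set (V → ℝ)} {β lam : V → ℝ}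
    (h : IsMinimizer L β lam) : penalty L β = Gam β lam := by
  refine IsLeast.csInf_eq ⟨⟨lam, h.1, rfl⟩, ?_⟩
  rintro _ ⟨lam', h', rfl⟩
  exact h.2 lam' h'

end GraphPenalty

theorem theorem5p1 {V : Type*} [Fintype V] (E : Set (V × V)) (r : V)
    (hE : GraphPenalty.IsDirectedTree E r) :
    -- the sets `U_C`, indexed by the cuts `C`, partition the vectors without zero component
    ((∀ C, GraphPenalty.IsCut E C → (GraphPenalty.U E C).Nonempty) ∧
      (∀ C₁ C₂, GraphPenalty.IsCut E C₁ → GraphPenalty.IsCut E C₂ → C₁ ≠ C₂ →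
        Disjoint (GraphPenalty.U E C₁) (GraphPenalty.U E C₂)) ∧
      (⋃ C ∈ {C | GraphPenalty.IsCut E C}, GraphPenalty.U E C) = GraphPenalty.nonzeroVecs V) ∧
    -- the penalty and the unique minimizer at such a vector
    ∀ β ∈ GraphPenalty.nonzeroVecs V,
      (∃! C, GraphPenalty.IsCut E C ∧ β ∈ GraphPenalty.U E C) ∧
      ∀ C, GraphPenalty.IsCut E C → β ∈ GraphPenalty.U E C →
        GraphPenalty.penalty (GraphPenalty.cone E) β =
            ∑ S ∈ GraphPenalty.parts E C, √(S.card : ℝ) * GraphPenalty.l2 β S ∧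
        ∃ lam : V → ℝ,
          (∀ lam', GraphPenalty.IsMinimizer (GraphPenalty.cone E) β lam' ↔ lam' = lam) ∧
          ∀ S ∈ GraphPenalty.parts E C, ∀ v ∈ S,
            lam v = √((1 / (S.card : ℝ)) * ∑ w ∈ S, β w ^ 2) := by
  refine ⟨⟨fun C _ => GraphPenalty.U_nonempty hE, ?_, ?_⟩, ?_⟩
  · intro C₁ C₂ h₁ h₂ hne
    rw [Set.disjoint_left]
    exact fun β hβ₁ hβ₂ => hne (GraphPenalty.cut_unique hE h₁ h₂ hβ₁ hβ₂)
  · refine Set.Subset.antisymm (Set.iUnion₂_subset fun C _ => Set.inter_subset_right) ?_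
    intro β hβ
    obtain ⟨C, hC, h⟩ := GraphPenalty.exists_cut hE hβ
    exact Set.mem_biUnion (show C ∈ {C | GraphPenalty.IsCut E C} from hC) h
  · intro β hβ
    refine ⟨?_, ?_⟩
    · obtain ⟨C, hC, h⟩ := GraphPenalty.exists_cut hE hβ
      exact ⟨C, ⟨hC, h⟩, fun C' h' => GraphPenalty.cut_unique hE h'.1 hC h'.2 h⟩
    · intro C _ h
      have hiff := GraphPenalty.isMinimizer_iff_eq_pooled hE h
      refine ⟨?_, GraphPenalty.pooled E C β, hiff, fun S hS v hv =>
        GraphPenalty.pooled_of_mem β hS hv⟩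
      rw [GraphPenalty.penalty_eq_of_isMinimizer ((hiff _).2 rfl), GraphPenalty.Gam_pooled hβ]
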